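/- **Conventions.** For a binary relation $R$ on a set $U$ and $A\subseteq U$ put $\overline R(A)=\{x\in U\mid \exists y\in A,\ xRy\}$. A *CF-approximation space* is a triple $(U,R,\mathcal F)$ with $U$ a nonempty set, $R$ a nonempty transitive relation on $U$, and $\mathcal F$ a nonempty family of finite (possibly empty) subsets of $U$, such that for all $F\in\mathcal F$ and all finite $K\subseteq\overline R(F)$ there is $G\in\mathcal F$ with $K\subseteq\overline R(G)$ and $G\subseteq\overline R(F)$. A set $E\subseteq U$ is *CF-closed* if for every finite $K\subseteq E$ there is $F\in\mathcal F$ with $K\subseteq\overline R(F)\subseteq E$ and $F\subseteq E$; $\mathfrak C(U,R,\mathcal F)$ denotes the collection of CF-closed sets, ordered by inclusion. A *CF-approximable relation* from $(U_1,R_1,\mathcal F_1)$ to $(U_2,R_2,\mathcal F_2)$ is a relation $\Theta\subseteq\mathcal F_1\times\mathcal F_2$ such that, for all $F,F'\in\mathcal F_1$ and $G,G',G_1,G_2\in\mathcal F_2$: (1) there is $H\in\mathcal F_2$ with $F\,\Theta\,H$; (2) if $F\subseteq\overline{R_1}(F')$ and $F\,\Theta\,G$, then $F'\,\Theta\,G$;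 (3) if $F\,\Theta\,G$ and $G'\subseteq\overline{R_2}(G)$, then $F\,\Theta\,G'$; (4) if $F\,\Theta\,G$, then there are $F''\in\mathcal F_1$, $G''\in\mathcal F_2$ with $F''\subseteq\overline{R_1}(F)$, $G\subseteq\overline{R_2}(G'')$ and $F''\,\Theta\,G''$; (5) if $F\,\Theta\,G_1$ and $F\,\Theta\,G_2$, then there is $G_3\in\mathcal F_2$ with $G_1\cup G_2\subseteq\overline{R_2}(G_3)$ and $F\,\Theta\,G_3$. These relations are composed as binary relations, and the identity on $(U,R,\mathcal F)$ is $\mathrm{Id}=\{(F,G)\in\mathcal F\times\mathcal F\mid G\subseteq\overline R(F)\}$. A *topological FS-approximation space* is a CF-approximation space $(U,R,\mathcal F)$ with $R$ a preorder for which there is a nonempty family $\{\Theta_i\}_{i\in I}$, directed under inclusion, of CF-approximable relations from $(U,R,\mathcal F)$ to itself such that $\bigcup_i\Theta_i=\mathrm{Id}$ and, for each $i$, there is a finite $\mathcal M_i\subseteq\mathcal F$ such that for every $F\in\mathcal F$ some $M\in\mathcal M_i$ satisfies: for all $G\in\mathcal F$, $F\,\Theta_i\,G$ implies $G\subseteq\overline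 R(M)\subseteq\overline R(F)$. **TopFS-APPS** is the category of topological FS-approximation spaces and CF-approximable relations. A *dcpo* is a poset in which every nonempty directed subset has a supremum; a map between dcpos is *Scott continuous* if it preserves suprema of nonempty directed sets. A nonempty dcpo $L$ is an *FS-domain* if there is a nonempty directed set $\mathcal D$ of Scott continuous maps $L\to L$ (in the pointwise order) with supremum $\mathrm{id}_L$ such that each $\delta\in\mathcal D$ is finitely separating, i.e. there is a finite $M_\delta\subseteq L$ such that for every $x\in L$ there is $m\in M_\delta$ with $\delta(x)\le m\le x$. An FS-domain is a *BF-domain* if it is algebraic, i.e. for every $x$ the compact elements below $x$ form a nonempty directed set with supremum $x$. **BF-DOM** is the category of BF-domains and Scott continuous maps. **Theorem.** Setting $\Psi(U,R,\mathcal F)=(\mathfrak C(U,R,\mathcal F),\subseteq)$ on objects and, for a CF-approximable relation $\Theta$ from $(U_1,R_1,\mathcal F_1)$ to $(U_2,R_2,\mathcal F_2)$, $\Psi(\Theta)=f_\Theta$ with $$f_\Theta(E)=\bigcup\{\overline{R_2}(G)\mid F\in\mathcal F_1,\ F\subseteq E,\ G\in\mathcal F_2,\ F\,\Theta\,G\}\qquad(E\in\mathfrak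 C(U_1,R_1,\mathcal F_1)),$$ gives a well-defined functor $\Psi:\textbf{TopFS-APPS}\to\textbf{BF-DOM}$, and $\Psi$ is an equivalence of categories. In particular the categories **TopFS-APPS** and **BF-DOM** are equivalent. -/

import Mathlib

open CategoryTheory

universe u v w

namespace FSApprox

/-! ### Domain theory -/

/-- Every (nonempty) directed subset has a supremum. -/
def IsDcpo (L : Type u) [PartialOrder L] : Prop :=
  ∀ D : Set L, D.Nonempty → DirectedOn (· ≤ ·) D → ∃ s, IsLUB D s

/-- For every `x`, the set of compact elements below `x` is directed (in particular nonempty)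
and has supremum `x`. -/
def IsAlgebraic (L : Type u) [PartialOrder L] : Prop :=
  ∀ x : L, {k : L | k ≤ x ∧ IsCompactElement k}.Nonempty ∧
    DirectedOn (· ≤ ·) {k : L | k ≤ x ∧ IsCompactElement k} ∧
    IsLUB {k : L | k ≤ x ∧ IsCompactElement k} x

/-- Scott continuous maps. -/
@[ext]
structure ScottMap (L : Type u) (M : Type v) [PartialOrder L] [PartialOrder M] where
  toFun : L → M
  scottContinuous : ScottContinuous toFun

namespace ScottMap

/-- The identity map. -/
def id (L : Type u) [PartialOrder L] : ScottMap L L where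
  toFun x := x
  scottContinuous := ScottContinuous.id

/-- `g.comp f` is `g` after `f`. -/
def comp {L : Type u} {M : Type v} {N : Type w} [PartialOrder L] [PartialOrder M]
    [PartialOrder N] (g : ScottMap M N) (f : ScottMap L M) : ScottMap L N where
  toFun x := g.toFun (f.toFun x)
  scottContinuous := ScottContinuous.comp f.scottContinuous g.scottContinuous

/-- The pointwise order. -/
instance {L : Type u} {M : Type v} [PartialOrder L] [PartialOrder M] :
    PartialOrder (ScottMap L M) :=
  PartialOrder.lift ScottMap.toFun (fun _ _ h => ScottMap.ext h)

/-- `δ` is finitely separating: for some finite set `m`, every `x` admits `a ∈ m` with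
`δ x ≤ a ≤ x`. -/
def IsFinitelySeparating {L : Type u} [PartialOrder L] (δ : ScottMap L L) : Prop :=
  ∃ m : Set L, m.Finite ∧ ∀ x : L, ∃ a ∈ m, δ.toFun x ≤ a ∧ a ≤ x

end ScottMap

/-- A set of Scott continuous self-maps which is directed in the pointwise order and whose
supremum is the identity. -/
def IsApproximateIdentity {L : Type u} [PartialOrder L] (D : Set (ScottMap L L)) : Prop :=
  D.Nonempty ∧ DirectedOn (· ≤ ·) D ∧ IsLUB D (ScottMap.id L)

/-- FS-domains. Domains are taken to be nonempty. -/
structure IsFSDomain (L : Type u) [PartialOrder L] : Prop where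
  nonempty : Nonempty L
  isDcpo : IsDcpo L
  exists_approximateIdentity : ∃ D : Set (ScottMap L L),
    IsApproximateIdentity D ∧ ∀ δ ∈ D, δ.IsFinitelySeparating

/-- BF-domains are the algebraic FS-domains. -/
structure IsBFDomain (L : Type u) [PartialOrder L] : Prop extends IsFSDomain L where
  isAlgebraic : IsAlgebraic L

/-- Objects of the category of BF-domains. -/
structure BFDom : Type (u + 1) where
  carrier : Type u
  [order : PartialOrder carrier]
  isBFDomain : IsBFDomain carrier

attribute [instance] BFDom.order

/-- The category of BF-domains and Scott continuous maps. -/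
instance : Category BFDom.{u} where
  Hom L M := ScottMap L.carrier M.carrier
  id L := ScottMap.id L.carrier
  comp f g := g.comp f

/-! ### CF-approximation spaces -/

/-- The upper approximation operator: `x ∈ upper R A` iff `R_s(x) = {y | x R y}` meets `A`. -/
def upper {U : Type u} (R : U → U → Prop) (A : Set U) : Set U :=
  {x | ({y | R x y} ∩ A).Nonempty}

/-- CF-approximation spaces: a nonempty set with a nonempty transitive relation and a nonempty
consistent family of finite subsets (the empty subset is allowed as a member). -/
structure CFSpace : Type (u + 1) where
  carrier : Type u
  carrier_nonempty : Nonempty carrier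
  R : carrier → carrier → Prop
  R_nonempty : ∃ x y, R x y
  R_trans : ∀ x y z, R x y → R y z → R x z
  fam : Set (Finset carrier)
  fam_nonempty : fam.Nonempty
  consistent : ∀ F ∈ fam, ∀ K : Finset carrier, (K : Set carrier) ⊆ upper R (F : Set carrier) →
    ∃ G ∈ fam, (K : Set carrier) ⊆ upper R (G : Set carrier) ∧
      (G : Set carrier) ⊆ upper R (F : Set carrier)

namespace CFSpace

/-- The upper approximation of a finite subset in a CF-approximation space. -/
def up (X : CFSpace.{u}) (F : Finset X.carrier) : Set X.carrier :=
  upper X.R (F : Set X.carrier)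

/-- CF-closed sets. -/
def IsCFClosed (X : CFSpace.{u}) (E : Set X.carrier) : Prop :=
  ∀ K : Finset X.carrier, (K : Set X.carrier) ⊆ E →
    ∃ F ∈ X.fam, (K : Set X.carrier) ⊆ X.up F ∧ X.up F ⊆ E ∧ (F : Set X.carrier) ⊆ E

/-- The collection of CF-closed sets; as a subtype of `Set X.carrier` it is ordered by
inclusion. -/
abbrev Closed (X : CFSpace.{u}) : Type u := {E : Set X.carrier // X.IsCFClosed E}

theorem up_subset_up (X : CFSpace.{u}) {F G : Finset X.carrier}
    (h : (F : Set X.carrier) ⊆ X.up G) : X.up F ⊆ X.up G := by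
  rintro x ⟨y, hxy, hy⟩
  obtain ⟨z, hyz, hz⟩ := h hy
  exact ⟨z, X.R_trans _ _ _ hxy hyz, hz⟩

end CFSpace

/-- CF-approximable relations from `X` to `Y`, as relations between the two families of finite
sets. -/
@[ext]
structure CFRel (X Y : CFSpace.{u}) where
  rel : X.fam → Y.fam → Prop
  total : ∀ F, ∃ G, rel F G
  up_left : ∀ (F F' : X.fam) (G : Y.fam),
    ((F : Finset X.carrier) : Set X.carrier) ⊆ X.up F' → rel F G → rel F' G
  down_right : ∀ (F : X.fam) (G G' : Y.fam),
    rel F G → ((G' : Finset Y.carrier) : Set Y.carrier) ⊆ Y.up G → rel F G'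
  interpolate : ∀ (F : X.fam) (G : Y.fam), rel F G → ∃ (F' : X.fam) (G' : Y.fam),
    ((F' : Finset X.carrier) : Set X.carrier) ⊆ X.up F ∧
      ((G : Finset Y.carrier) : Set Y.carrier) ⊆ Y.up G' ∧ rel F' G'
  directed : ∀ (F : X.fam) (G₁ G₂ : Y.fam), rel F G₁ → rel F G₂ → ∃ G₃ : Y.fam,
    ((G₁ : Finset Y.carrier) : Set Y.carrier) ∪ ((G₂ : Finset Y.carrier) : Set Y.carrier) ⊆
      Y.up G₃ ∧ rel F G₃

namespace CFRel

/-- The identity CF-approximable relation: `F` is related to `G` iff `G ⊆ up F`. -/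
def id (X : CFSpace.{u}) : CFRel X X where
  rel F G := ((G : Finset X.carrier) : Set X.carrier) ⊆ X.up F
  total F := by
    obtain ⟨G, hG, -, h⟩ := X.consistent F F.2 ∅ (by simp)
    exact ⟨⟨G, hG⟩, h⟩
  up_left _ _ _ h h' := h'.trans (X.up_subset_up h)
  down_right _ _ _ h h' := h'.trans (X.up_subset_up h)
  interpolate F G h := by
    obtain ⟨H, hH, h₁, h₂⟩ := X.consistent F F.2 G h
    obtain ⟨H', hH', h₃, h₄⟩ := X.consistent H hH G h₁
    exact ⟨⟨H, hH⟩, ⟨H', hH'⟩, h₂, h₃, h₄⟩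
  directed F G₁ G₂ h₁ h₂ := by
    classical
    obtain ⟨H, hH, h₃, h₄⟩ := X.consistent F F.2 ((G₁ : Finset X.carrier) ∪ G₂)
      (by rw [Finset.coe_union]; exact Set.union_subset h₁ h₂)
    exact ⟨⟨H, hH⟩, by rw [← Finset.coe_union]; exact h₃, h₄⟩

/-- Composition of relations: `Υ.comp Θ` is `Υ` after `Θ`. -/
def comp {X Y Z : CFSpace.{u}} (Υ : CFRel Y Z) (Θ : CFRel X Y) : CFRel X Z where
  rel F H := ∃ G, Θ.rel F G ∧ Υ.rel G H
  total F := by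
    obtain ⟨G, hG⟩ := Θ.total F
    obtain ⟨H, hH⟩ := Υ.total G
    exact ⟨H, G, hG, hH⟩
  up_left F F' H h := fun ⟨G, h₁, h₂⟩ => ⟨G, Θ.up_left F F' G h h₁, h₂⟩
  down_right F H H' := fun ⟨G, h₁, h₂⟩ h => ⟨G, h₁, Υ.down_right G H H' h₂ h⟩
  interpolate F H := by
    rintro ⟨G, h₁, h₂⟩
    obtain ⟨F', G', a₁, a₂, a₃⟩ := Θ.interpolate F G h₁
    obtain ⟨G'', H', b₁, b₂, b₃⟩ := Υ.interpolate G H h₂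
    exact ⟨F', H', a₁, b₂, G, Θ.down_right _ _ _ a₃ a₂, Υ.up_left _ _ _ b₁ b₃⟩
  directed F H₁ H₂ := by
    rintro ⟨G₁, a₁, b₁⟩ ⟨G₂, a₂, b₂⟩
    obtain ⟨G₃, hG, a₃⟩ := Θ.directed F G₁ G₂ a₁ a₂
    obtain ⟨H₃, hH, b₃⟩ := Υ.directed G₃ H₁ H₂
      (Υ.up_left _ _ _ (Set.subset_union_left.trans hG) b₁)
      (Υ.up_left _ _ _ (Set.subset_union_right.trans hG) b₂)
    exact ⟨H₃, hH, G₃, a₃, b₃⟩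

theorem id_comp {X Y : CFSpace.{u}} (Θ : CFRel X Y) : (CFRel.id Y).comp Θ = Θ := by
  ext F G
  constructor
  · rintro ⟨G', h₁, h₂⟩
    exact Θ.down_right _ _ _ h₁ h₂
  · intro h
    obtain ⟨F', G', h₁, h₂, h₃⟩ := Θ.interpolate F G h
    exact ⟨G', Θ.up_left _ _ _ h₁ h₃, h₂⟩

theorem comp_id {X Y : CFSpace.{u}} (Θ : CFRel X Y) : Θ.comp (CFRel.id X) = Θ := by
  ext F G
  constructor
  · rintro ⟨F', h₁, h₂⟩
    exact Θ.up_left _ _ _ h₁ h₂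
  · intro h
    obtain ⟨F', G', h₁, h₂, h₃⟩ := Θ.interpolate F G h
    exact ⟨F', h₁, Θ.down_right _ _ _ h₃ h₂⟩

/-- The set `⋃ {up G | F ∈ X.fam, F ⊆ E, G ∈ Y.fam, F Θ G}`. -/
def imageSet {X Y : CFSpace.{u}} (Θ : CFRel X Y) (E : Set X.carrier) : Set Y.carrier :=
  ⋃₀ {A | ∃ (F : X.fam) (G : Y.fam), ((F : Finset X.carrier) : Set X.carrier) ⊆ E ∧
    Θ.rel F G ∧ A = Y.up G}

theorem isCFClosed_imageSet {X Y : CFSpace.{u}} (Θ : CFRel X Y) (E : X.Closed) :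
    Y.IsCFClosed (Θ.imageSet E.1) := by
  classical
  intro K hK
  have key : ∀ K : Finset Y.carrier, (K : Set Y.carrier) ⊆ Θ.imageSet E.1 →
      ∃ (F : X.fam) (G : Y.fam), ((F : Finset X.carrier) : Set X.carrier) ⊆ E.1 ∧
        Θ.rel F G ∧ (K : Set Y.carrier) ⊆ Y.up G := by
    intro K
    induction K using Finset.induction_on with
    | empty =>
      intro _
      obtain ⟨F, hF, -, -, h⟩ := E.2 ∅ (by simp)
      obtain ⟨G, hG⟩ := Θ.total ⟨F, hF⟩
      exact ⟨⟨F, hF⟩, G, h, hG, by simp⟩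
    | insert x K _ ih =>
      intro hK
      rw [Finset.coe_insert, Set.insert_subset_iff] at hK
      obtain ⟨⟨_, ⟨F₁, G₁, hF₁, hr₁, rfl⟩, hx⟩, hK⟩ := hK
      obtain ⟨F₂, G₂, hF₂, hr₂, hK₂⟩ := ih hK
      obtain ⟨F₃, hF₃, hU, -, hE⟩ := E.2 ((F₁ : Finset X.carrier) ∪ F₂)
        (by rw [Finset.coe_union]; exact Set.union_subset hF₁ hF₂)
      rw [Finset.coe_union] at hU
      obtain ⟨G₃, hG, hr₃⟩ := Θ.directed ⟨F₃, hF₃⟩ G₁ G₂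
        (Θ.up_left _ _ _ (Set.subset_union_left.trans hU) hr₁)
        (Θ.up_left _ _ _ (Set.subset_union_right.trans hU) hr₂)
      refine ⟨⟨F₃, hF₃⟩, G₃, hE, hr₃, ?_⟩
      rw [Finset.coe_insert, Set.insert_subset_iff]
      exact ⟨Y.up_subset_up (Set.subset_union_left.trans hG) hx,
        hK₂.trans (Y.up_subset_up (Set.subset_union_right.trans hG))⟩
  obtain ⟨F, G, hF, hr, hKG⟩ := key K hK
  have hsub : Y.up G ⊆ Θ.imageSet E.1 := Set.subset_sUnion_of_mem ⟨F, G, hF, hr, rfl⟩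
  obtain ⟨H, hH, h₁, h₂⟩ := Y.consistent G G.2 K hKG
  exact ⟨H, hH, h₁, (Y.up_subset_up h₂).trans hsub, h₂.trans hsub⟩

/-- The map `f_Θ` between the collections of CF-closed sets. -/
def toMap {X Y : CFSpace.{u}} (Θ : CFRel X Y) (E : X.Closed) : Y.Closed :=
  ⟨Θ.imageSet E.1, Θ.isCFClosed_imageSet E⟩

end CFRel

/-! ### Topological FS-approximation spaces -/

/-- FS-approximation spaces: there is a (nonempty) family of CF-approximable relations on `X`,
directed under inclusion, with union the identity relation, such that for each member `Θ` there is
a finite `ℳ ⊆ X.fam` for which every `F ∈ X.fam` admits `M ∈ ℳ` with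
`G ⊆ up M ⊆ up F` whenever `F Θ G`. -/
def CFSpace.IsFS (X : CFSpace.{u}) : Prop :=
  ∃ D : Set (CFRel X X), D.Nonempty ∧
    DirectedOn (fun Θ Θ' => ∀ F G, Θ.rel F G → Θ'.rel F G) D ∧
    (∀ F G, (∃ Θ ∈ D, Θ.rel F G) ↔ (CFRel.id X).rel F G) ∧
    ∀ Θ ∈ D, ∃ ℳ : Set X.fam, ℳ.Finite ∧ ∀ F : X.fam, ∃ M ∈ ℳ, ∀ G : X.fam, Θ.rel F G →
      ((G : Finset X.carrier) : Set X.carrier) ⊆ X.up M ∧ X.up M ⊆ X.up F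

/-- Topological FS-approximation spaces: FS-approximation spaces whose relation is a preorder
(transitivity being part of the definition of a CF-approximation space). -/
structure TopFSApps : Type (u + 1) where
  space : CFSpace.{u}
  R_refl : ∀ x, space.R x x
  isFS : space.IsFS

/-- The category of topological FS-approximation spaces and CF-approximable relations. -/
instance : Category TopFSApps.{u} where
  Hom X Y := CFRel X.space Y.space
  id X := CFRel.id X.space
  comp Θ Υ := Υ.comp Θ
  id_comp Θ := Θ.comp_id
  comp_id Θ := Θ.id_comp
  assoc Θ Υ Ω := by
    refine CFRel.ext ?_
    funext F H
    simp only [CFRel.comp, eq_iff_iff]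
    tauto

end FSApprox

/-!
When `R` is a preorder, a CF-closed set `E` is the directed union of the sets `up F` with `F ∈ fam`
and `F ⊆ E`, and these sets `up F` are exactly the compact elements of the dcpo of CF-closed sets
(directed suprema are unions, and `F` is finite). So `Closed X` is algebraic, and a Scott continuous
map out of it is the same thing as a CF-approximable relation: `F Θ G` corresponds to `G ⊆ f (up F)`.
This makes the functor full and faithful (`CFRel.toMap_ofScottMap`, `CFRel.rel_iff_subset_toMap_up`).

A family `Θ_i` witnessing the FS property of `X` is sent to an approximate identity on `Closed X`.
The separating set of `f_Θ` consists of the sets `up M`, `M ∈ ℳ`: if none of them separated `E`,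
the finitely many witnesses for this would be contained in a single `up F` with `F ⊆ E`, against the
choice of `M` for `F` (`CFRel.isFinitelySeparating_toScottMap`).

For essential surjectivity a BF-domain `L` is recovered, as an ordered set, from the space
`compactSpace L` of its compact elements with the singletons as family, whose CF-closed sets are the
ideals of compact elements (`closedCompactSpaceIso`). To see that this space is FS, the finite
separating set of a map `δ` has to be replaced by one of compact elements. If `δ` is finitely
separating, then `δ a` lies way below `a`, so that by algebraicity a compact element fits between
`δ a` and `a` (`exists_compact_between`). Choosing such an element for each `a` in the separating set
of `δ` gives a finite set of compact elements which separates `δ ∘ δ`. The maps `δ ∘ δ` still form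
an approximate identity, because suprema of directed sets of Scott continuous maps are pointwise
(`IsApproximateIdentity.isLUB_apply`).
-/

namespace FSApprox

/-! ### Directed sets and Scott continuous maps -/

theorem exists_mem_forall_le_of_finite {L : Type u} [PartialOrder L] {s t : Set L}
    (hs : s.Nonempty) (hd : DirectedOn (· ≤ ·) s) (ht : t.Finite) (hts : t ⊆ s) :
    ∃ c ∈ s, ∀ x ∈ t, x ≤ c := by
  induction t, ht using Set.Finite.induction_on with
  | empty => exact hs.imp fun c hc => ⟨hc, by simp⟩
  | insert _ _ ih =>
    rw [Set.insert_subset_iff] at hts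
    obtain ⟨c, hc, h⟩ := ih hts.2
    obtain ⟨d, hd, h₁, h₂⟩ := hd _ hts.1 _ hc
    refine ⟨d, hd, ?_⟩
    rintro x (rfl | hx)
    exacts [h₁, (h x hx).trans h₂]

/-- An order isomorphism as a Scott continuous map. -/
def ScottMap.ofOrderIso {L : Type u} {M : Type v} [PartialOrder L] [PartialOrder M] (e : L ≃o M) :
    ScottMap L M where
  toFun := e
  scottContinuous _ _ _ _ h := e.isLUB_image'.2 h

/-- The supremum of an approximate identity is computed pointwise: the pointwise supremum is
itself Scott continuous, hence is the least upper bound among Scott continuous maps. -/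
theorem IsApproximateIdentity.isLUB_apply {L : Type u} [PartialOrder L] (hL : IsDcpo L)
    {D : Set (ScottMap L L)} (hD : IsApproximateIdentity D) (x : L) :
    IsLUB ((fun δ : ScottMap L L => δ.toFun x) '' D) x := by
  obtain ⟨hne, hdir, hlub⟩ := hD
  have hex : ∀ x, ∃ s, IsLUB ((fun δ : ScottMap L L => δ.toFun x) '' D) s := fun x =>
    hL _ (hne.image _) (by
      rintro _ ⟨δ₁, h₁, rfl⟩ _ ⟨δ₂, h₂, rfl⟩
      obtain ⟨δ, h, h₃, h₄⟩ := hdir _ h₁ _ h₂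
      exact ⟨_, ⟨δ, h, rfl⟩, h₃ x, h₄ x⟩)
  choose s hs using hex
  have hle : ∀ δ ∈ D, ∀ x, δ.toFun x ≤ s x := fun δ hδ x => (hs x).1 ⟨δ, hδ, rfl⟩
  have hcont : ScottContinuous s := by
    intro d hd₁ hd₂ a ha
    constructor
    · rintro _ ⟨x, hx, rfl⟩
      refine (hs x).2 ?_
      rintro _ ⟨δ, hδ, rfl⟩
      exact (δ.scottContinuous.monotone (ha.1 hx)).trans (hle δ hδ a)
    · intro b hb
      refine (hs a).2 ?_
      rintro _ ⟨δ, hδ, rfl⟩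
      refine (δ.scottContinuous hd₁ hd₂ ha).2 ?_
      rintro _ ⟨x, hx, rfl⟩
      exact (hle δ hδ x).trans (hb ⟨x, hx, rfl⟩)
  have h₁ : ScottMap.id L ≤ ⟨s, hcont⟩ := hlub.2 fun δ hδ => hle δ hδ
  have h₂ : s x ≤ x := by
    refine (hs x).2 ?_
    rintro _ ⟨δ, hδ, rfl⟩
    exact hlub.1 hδ x
  have h₃ : s x = x := le_antisymm h₂ (h₁ x)
  simpa only [h₃] using hs x

/-- A finitely separating map sends each `a` way below `a`; in an algebraic poset this means that
a compact element lies between `δ a` and `a`. -/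
theorem exists_compact_between {L : Type u} [PartialOrder L] (hL : IsAlgebraic L)
    {δ : ScottMap L L} (hδ : δ.IsFinitelySeparating) (a : L) :
    ∃ c, IsCompactElement c ∧ δ.toFun a ≤ c ∧ c ≤ a := by
  obtain ⟨hne, hdir, hlub⟩ := hL a
  obtain ⟨m, hm, hsep⟩ := hδ
  have hδa := δ.scottContinuous hne hdir hlub
  by_contra! hcon
  -- No member of `m` below a compact approximation of `a` can bound `δ a`, so each of them fails
  -- to bound `δ` at some approximation; a common upper bound of these contradicts separation.
  have key : ∀ b : L, ∃ c, (c ≤ a ∧ IsCompactElement c) ∧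
      ((∃ c', (c' ≤ a ∧ IsCompactElement c') ∧ b ≤ c') → ¬ δ.toFun c ≤ b) := by
    intro b
    by_cases hb : ∃ c', (c' ≤ a ∧ IsCompactElement c') ∧ b ≤ c'
    · obtain ⟨c', hc', hbc⟩ := hb
      by_contra! hall
      refine hcon c' hc'.2 (hδa.2 ?_) hc'.1
      rintro _ ⟨c, hc, rfl⟩
      exact (hall c hc).2.trans hbc
    · exact hne.imp fun c hc => ⟨hc, fun h => (hb h).elim⟩
  choose c hc hcb using key
  obtain ⟨d, hd, hdle⟩ := exists_mem_forall_le_of_finite hne hdir (hm.image c)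
    (by rintro _ ⟨b, -, rfl⟩; exact hc b)
  obtain ⟨b, hb, h₁, h₂⟩ := hsep d
  exact hcb b ⟨d, hd, h₂⟩ ((δ.scottContinuous.monotone (hdle _ ⟨b, hb, rfl⟩)).trans h₁)

/-! ### The dcpo of CF-closed sets -/

namespace CFSpace

variable {X : CFSpace.{u}}

/-- The basic CF-closed set `up F`, for `F` in the family of `X`. -/
def upClosed (X : CFSpace.{u}) (F : X.fam) : X.Closed :=
  ⟨X.up F, fun K hK =>
    let ⟨G, hG, h₁, h₂⟩ := X.consistent F F.2 K hK
    ⟨G, hG, h₁, X.up_subset_up h₂, h₂⟩⟩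

theorem subset_up (hX : ∀ x, X.R x x) (F : Finset X.carrier) : (F : Set X.carrier) ⊆ X.up F :=
  fun x hx => ⟨x, hX x, hx⟩

theorem up_subset_closed (E : X.Closed) {F : Finset X.carrier} (hF : (F : Set X.carrier) ⊆ E.1) :
    X.up F ⊆ E.1 := by
  obtain ⟨G, -, h₁, h₂, -⟩ := E.2 F hF
  exact (X.up_subset_up h₁).trans h₂

theorem exists_mem_subset_of_subset_biUnion {D : Set X.Closed} (hn : D.Nonempty)
    (hd : DirectedOn (· ≤ ·) D) {K : Finset X.carrier}
    (hK : (K : Set X.carrier) ⊆ ⋃ E ∈ D, E.1) : ∃ E ∈ D, (K : Set X.carrier) ⊆ E.1 :=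
  DirectedOn.exists_mem_subset_of_finset_subset_biUnion (f := Subtype.val) hn hd hK

theorem isCFClosed_biUnion {D : Set X.Closed} (hn : D.Nonempty) (hd : DirectedOn (· ≤ ·) D) :
    X.IsCFClosed (⋃ E ∈ D, E.1) := by
  intro K hK
  obtain ⟨E, hE, hKE⟩ := exists_mem_subset_of_subset_biUnion hn hd hK
  obtain ⟨F, hF, h₁, h₂, h₃⟩ := E.2 K hKE
  have hsub : E.1 ⊆ ⋃ E ∈ D, E.1 := Set.subset_biUnion_of_mem (u := Subtype.val) hE
  exact ⟨F, hF, h₁, h₂.trans hsub, h₃.trans hsub⟩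

theorem isLUB_biUnion {D : Set X.Closed} (hn : D.Nonempty) (hd : DirectedOn (· ≤ ·) D) :
    IsLUB D (⟨⋃ E ∈ D, E.1, isCFClosed_biUnion hn hd⟩ : X.Closed) :=
  ⟨fun _ hE => Set.subset_biUnion_of_mem (u := Subtype.val) hE, fun _ hT => Set.iUnion₂_subset hT⟩

theorem isDcpo_closed : IsDcpo X.Closed :=
  fun _ hn hd => ⟨_, isLUB_biUnion hn hd⟩

theorem exists_mem_subset_of_isLUB {D : Set X.Closed} (hn : D.Nonempty)
    (hd : DirectedOn (· ≤ ·) D) {S : X.Closed} (hS : IsLUB D S) {K : Finset X.carrier}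
    (hK : (K : Set X.carrier) ⊆ S.1) : ∃ E ∈ D, (K : Set X.carrier) ⊆ E.1 := by
  obtain rfl := hS.unique (isLUB_biUnion hn hd)
  exact exists_mem_subset_of_subset_biUnion hn hd hK

theorem isCompactElement_upClosed (hX : ∀ x, X.R x x) (F : X.fam) :
    IsCompactElement (X.upClosed F) := by
  intro D S hn hd hS hF
  obtain ⟨E, hE, h⟩ := exists_mem_subset_of_isLUB hn hd hS ((subset_up hX _).trans hF)
  exact ⟨E, hE, up_subset_closed E h⟩

/-- The basic closed sets `up F` with `F ⊆ E`; they form a directed set with union `E`. -/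
def basicBelow (E : X.Closed) : Set X.Closed :=
  {A | ∃ F : X.fam, ((F : Finset X.carrier) : Set X.carrier) ⊆ E.1 ∧ A = X.upClosed F}

theorem basicBelow_nonempty (E : X.Closed) : (basicBelow E).Nonempty := by
  obtain ⟨F, hF, -, -, h⟩ := E.2 ∅ (by simp)
  exact ⟨_, ⟨F, hF⟩, h, rfl⟩

theorem directedOn_basicBelow (E : X.Closed) : DirectedOn (· ≤ ·) (basicBelow E) := by
  classical
  rintro _ ⟨F₁, h₁, rfl⟩ _ ⟨F₂, h₂, rfl⟩
  obtain ⟨F, hF, hU, -, hE⟩ := E.2 ((F₁ : Finset X.carrier) ∪ F₂)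
    (by rw [Finset.coe_union]; exact Set.union_subset h₁ h₂)
  rw [Finset.coe_union] at hU
  exact ⟨_, ⟨⟨F, hF⟩, hE, rfl⟩, X.up_subset_up (Set.subset_union_left.trans hU),
    X.up_subset_up (Set.subset_union_right.trans hU)⟩

theorem isLUB_basicBelow (E : X.Closed) : IsLUB (basicBelow E) E := by
  constructor
  · rintro _ ⟨F, hF, rfl⟩
    exact up_subset_closed E hF
  · intro T hT x hx
    obtain ⟨F, hF, h₁, -, h₂⟩ := E.2 {x} (by simpa using hx)
    exact hT ⟨⟨F, hF⟩, h₂, rfl⟩ (h₁ (by simp))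

theorem compact_below_eq_basicBelow (hX : ∀ x, X.R x x) (E : X.Closed) :
    {A : X.Closed | A ≤ E ∧ IsCompactElement A} = basicBelow E := by
  ext A
  constructor
  · rintro ⟨hAE, hA⟩
    obtain ⟨_, ⟨F, hF, rfl⟩, h⟩ := hA _ A (basicBelow_nonempty A) (directedOn_basicBelow A)
      (isLUB_basicBelow A) le_rfl
    exact ⟨F, hF.trans hAE, le_antisymm h (up_subset_closed A hF)⟩
  · rintro ⟨F, hF, rfl⟩
    exact ⟨up_subset_closed E hF, isCompactElement_upClosed hX F⟩

theorem isAlgebraic_closed (hX : ∀ x, X.R x x) : IsAlgebraic X.Closed := fun E => by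
  rw [compact_below_eq_basicBelow hX]
  exact ⟨basicBelow_nonempty E, directedOn_basicBelow E, isLUB_basicBelow E⟩

end CFSpace

/-! ### CF-approximable relations and Scott continuous maps -/

namespace CFRel

variable {X Y Z : CFSpace.{u}}

theorem mem_toMap {Θ : CFRel X Y} {E : X.Closed} {y : Y.carrier} :
    y ∈ (Θ.toMap E).1 ↔ ∃ (F : X.fam) (G : Y.fam),
      ((F : Finset X.carrier) : Set X.carrier) ⊆ E.1 ∧ Θ.rel F G ∧ y ∈ Y.up G := by
  constructor
  · rintro ⟨_, ⟨F, G, hF, hr, rfl⟩, hy⟩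
    exact ⟨F, G, hF, hr, hy⟩
  · rintro ⟨F, G, hF, hr, hy⟩
    exact ⟨_, ⟨F, G, hF, hr, rfl⟩, hy⟩

theorem up_subset_toMap {Θ : CFRel X Y} {E : X.Closed} {F : X.fam} {G : Y.fam}
    (hF : ((F : Finset X.carrier) : Set X.carrier) ⊆ E.1) (h : Θ.rel F G) :
    Y.up G ⊆ (Θ.toMap E).1 :=
  fun _ hy => mem_toMap.2 ⟨F, G, hF, h, hy⟩

/-- The union defining `f_Θ E` is directed: a finite subset lies in one of its members. -/
theorem exists_rel_of_subset_toMap (Θ : CFRel X Y) (E : X.Closed) (K : Finset Y.carrier)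
    (hK : (K : Set Y.carrier) ⊆ (Θ.toMap E).1) :
    ∃ (F : X.fam) (G : Y.fam), ((F : Finset X.carrier) : Set X.carrier) ⊆ E.1 ∧
      Θ.rel F G ∧ (K : Set Y.carrier) ⊆ Y.up G := by
  classical
  induction K using Finset.induction_on with
  | empty =>
    obtain ⟨F, hF, -, -, h⟩ := E.2 ∅ (by simp)
    obtain ⟨G, hG⟩ := Θ.total ⟨F, hF⟩
    exact ⟨⟨F, hF⟩, G, h, hG, by simp⟩
  | insert x K _ ih =>
    rw [Finset.coe_insert, Set.insert_subset_iff] at hK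
    obtain ⟨F₁, G₁, hF₁, hr₁, hx⟩ := mem_toMap.1 hK.1
    obtain ⟨F₂, G₂, hF₂, hr₂, hK₂⟩ := ih hK.2
    obtain ⟨F₃, hF₃, hU, -, hE⟩ := E.2 ((F₁ : Finset X.carrier) ∪ F₂)
      (by rw [Finset.coe_union]; exact Set.union_subset hF₁ hF₂)
    rw [Finset.coe_union] at hU
    obtain ⟨G₃, hG, hr₃⟩ := Θ.directed ⟨F₃, hF₃⟩ G₁ G₂
      (Θ.up_left _ _ _ (Set.subset_union_left.trans hU) hr₁)
      (Θ.up_left _ _ _ (Set.subset_union_right.trans hU) hr₂)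
    refine ⟨⟨F₃, hF₃⟩, G₃, hE, hr₃, ?_⟩
    rw [Finset.coe_insert, Set.insert_subset_iff]
    exact ⟨Y.up_subset_up (Set.subset_union_left.trans hG) hx,
      hK₂.trans (Y.up_subset_up (Set.subset_union_right.trans hG))⟩

theorem scottContinuous_toMap (Θ : CFRel X Y) : ScottContinuous Θ.toMap := by
  intro D hn hd S hS
  constructor
  · rintro _ ⟨E, hE, rfl⟩ y hy
    obtain ⟨F, G, hF, hr, hy⟩ := mem_toMap.1 hy
    exact mem_toMap.2 ⟨F, G, hF.trans (hS.1 hE), hr, hy⟩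
  · intro T hT y hy
    obtain ⟨F, G, hF, hr, hy⟩ := mem_toMap.1 hy
    obtain ⟨E, hE, hFE⟩ := CFSpace.exists_mem_subset_of_isLUB hn hd hS hF
    exact hT ⟨E, hE, rfl⟩ (up_subset_toMap hFE hr hy)

/-- The Scott continuous map `f_Θ`. -/
def toScottMap (Θ : CFRel X Y) : ScottMap X.Closed Y.Closed :=
  ⟨Θ.toMap, Θ.scottContinuous_toMap⟩

theorem toMap_id (X : CFSpace.{u}) (E : X.Closed) : (CFRel.id X).toMap E = E := by
  refine Subtype.ext (Set.Subset.antisymm ?_ ?_)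
  · intro x hx
    obtain ⟨F, G, hF, hr, hx⟩ := mem_toMap.1 hx
    exact CFSpace.up_subset_closed E hF (X.up_subset_up hr hx)
  · intro x hx
    obtain ⟨F, hF, h₁, -, h₂⟩ := E.2 {x} (by simpa using hx)
    obtain ⟨G, hG, h₃, h₄⟩ := X.consistent F hF {x} h₁
    exact mem_toMap.2 ⟨⟨F, hF⟩, ⟨G, hG⟩, h₂, h₄, h₃ (by simp)⟩

theorem toMap_comp (Υ : CFRel Y Z) (Θ : CFRel X Y) (E : X.Closed) :
    (Υ.comp Θ).toMap E = Υ.toMap (Θ.toMap E) := by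
  refine Subtype.ext (Set.Subset.antisymm ?_ ?_)
  · intro z hz
    obtain ⟨F, H, hF, ⟨G, h₁, h₂⟩, hz⟩ := mem_toMap.1 hz
    obtain ⟨G', H', h₃, h₄, h₅⟩ := Υ.interpolate G H h₂
    exact mem_toMap.2 ⟨G', H', h₃.trans (up_subset_toMap hF h₁), h₅, Z.up_subset_up h₄ hz⟩
  · intro z hz
    obtain ⟨G, H, hG, hr, hz⟩ := mem_toMap.1 hz
    obtain ⟨F, G', hF, h₁, h₂⟩ := exists_rel_of_subset_toMap Θ E G hG
    exact mem_toMap.2 ⟨F, H, hF, ⟨G', h₁, Υ.up_left _ _ _ h₂ hr⟩, hz⟩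

/-- Over reflexive spaces the relation is recovered from the values of `f_Θ` at basic closed
sets. -/
theorem rel_iff_subset_toMap_up (hX : ∀ x, X.R x x) (hY : ∀ y, Y.R y y) (Θ : CFRel X Y)
    (F : X.fam) (G : Y.fam) :
    Θ.rel F G ↔ ((G : Finset Y.carrier) : Set Y.carrier) ⊆ (Θ.toMap (X.upClosed F)).1 := by
  constructor
  · intro h
    exact (CFSpace.subset_up hY _).trans (up_subset_toMap (CFSpace.subset_up hX _) h)
  · intro h
    obtain ⟨F', G', h₁, h₂, h₃⟩ := exists_rel_of_subset_toMap Θ _ _ h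
    exact Θ.down_right _ _ _ (Θ.up_left _ _ _ h₁ h₂) h₃

theorem toMap_injective (hX : ∀ x, X.R x x) (hY : ∀ y, Y.R y y) {Θ Υ : CFRel X Y}
    (h : Θ.toMap = Υ.toMap) : Θ = Υ := by
  ext F G
  rw [rel_iff_subset_toMap_up hX hY, rel_iff_subset_toMap_up hX hY, h]

/-- The relation `G ⊆ f (up F)` attached to a Scott continuous map `f` between the dcpos of closed
sets of reflexive spaces. -/
def ofScottMap (hX : ∀ x, X.R x x) (hY : ∀ y, Y.R y y) (f : ScottMap X.Closed Y.Closed) :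
    CFRel X Y where
  rel F G := ((G : Finset Y.carrier) : Set Y.carrier) ⊆ (f.toFun (X.upClosed F)).1
  total F := by
    obtain ⟨G, hG, -, -, h⟩ := (f.toFun (X.upClosed F)).2 ∅ (by simp)
    exact ⟨⟨G, hG⟩, h⟩
  up_left F F' G h h' := h'.trans
    (f.scottContinuous.monotone (show X.upClosed F ≤ X.upClosed F' from X.up_subset_up h))
  down_right F G G' h h' := h'.trans (CFSpace.up_subset_closed _ h)
  interpolate F G h := ⟨F, G, CFSpace.subset_up hX _, CFSpace.subset_up hY _, h⟩
  directed F G₁ G₂ h₁ h₂ := by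
    classical
    obtain ⟨G, hG, hU, -, h⟩ := (f.toFun (X.upClosed F)).2 ((G₁ : Finset Y.carrier) ∪ G₂)
      (by rw [Finset.coe_union]; exact Set.union_subset h₁ h₂)
    exact ⟨⟨G, hG⟩, by rwa [Finset.coe_union] at hU, h⟩

theorem toMap_ofScottMap (hX : ∀ x, X.R x x) (hY : ∀ y, Y.R y y)
    (f : ScottMap X.Closed Y.Closed) : (ofScottMap hX hY f).toScottMap = f := by
  refine ScottMap.ext (funext fun E => le_antisymm ?_ ?_)
  · intro y hy
    obtain ⟨F, G, hF, hr, hy⟩ := mem_toMap.1 hy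
    exact f.scottContinuous.monotone
      (show X.upClosed F ≤ E from CFSpace.up_subset_closed E hF)
      (CFSpace.up_subset_closed _ hr hy)
  · refine (f.scottContinuous (CFSpace.basicBelow_nonempty E) (CFSpace.directedOn_basicBelow E)
      (CFSpace.isLUB_basicBelow E)).2 ?_
    rintro _ ⟨_, ⟨F, hF, rfl⟩, rfl⟩ y hy
    obtain ⟨G, hG, h₁, -, h₂⟩ := (f.toFun (X.upClosed F)).2 {y} (by simpa using hy)
    exact mem_toMap.2 ⟨F, ⟨G, hG⟩, hF, h₂, h₁ (by simp)⟩

/-! ### Closed sets of a topological FS-approximation space form a BF-domain -/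

theorem isFinitelySeparating_toScottMap {Θ : CFRel X X} {ℳ : Set X.fam} (hℳ : ℳ.Finite)
    (h : ∀ F : X.fam, ∃ M ∈ ℳ, ∀ G : X.fam, Θ.rel F G →
      ((G : Finset X.carrier) : Set X.carrier) ⊆ X.up M ∧ X.up M ⊆ X.up F) :
    Θ.toScottMap.IsFinitelySeparating := by
  classical
  refine ⟨X.upClosed '' ℳ, hℳ.image _, fun E => ?_⟩
  by_contra! hcon
  -- `W M` witnesses that `up M` fails to bound `f_Θ E` whenever `up M ≤ E`.
  have key : ∀ M : X.fam, ∃ W : X.fam, ((W : Finset X.carrier) : Set X.carrier) ⊆ E.1 ∧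
      (M ∈ ℳ → X.upClosed M ≤ E → ∃ G, Θ.rel W G ∧
        ¬ ((G : Finset X.carrier) : Set X.carrier) ⊆ X.up M) := by
    intro M
    by_contra! hall
    obtain ⟨W, hW, -, -, hWE⟩ := E.2 ∅ (by simp)
    obtain ⟨hM, hME, -⟩ := hall ⟨W, hW⟩ hWE
    refine hcon _ ⟨M, hM, rfl⟩ (fun y hy => ?_) hME
    obtain ⟨F, G, hF, hr, hy⟩ := mem_toMap.1 hy
    exact X.up_subset_up ((hall F hF).2.2 G hr) hy
  choose W hWE hW using key
  obtain ⟨F, hF, hKF, -, hFE⟩ := E.2 (hℳ.toFinset.biUnion fun M => (W M : Finset X.carrier)) (by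
    intro x hx
    simp only [Finset.coe_biUnion, Set.mem_iUnion] at hx
    obtain ⟨M, -, hx⟩ := hx
    exact hWE M hx)
  obtain ⟨M, hM, hMF⟩ := h ⟨F, hF⟩
  obtain ⟨G₀, hG₀⟩ := Θ.total ⟨F, hF⟩
  obtain ⟨G, hr, hG⟩ := hW M hM ((hMF G₀ hG₀).2.trans (CFSpace.up_subset_closed E hFE))
  refine hG (hMF G (Θ.up_left _ _ _ ?_ hr)).1
  refine Set.Subset.trans ?_ hKF
  exact_mod_cast Finset.subset_biUnion_of_mem (fun M => (W M : Finset X.carrier))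
    (hℳ.mem_toFinset.2 hM)

end CFRel

theorem TopFSApps.isBFDomain_closed (X : TopFSApps.{u}) : IsBFDomain X.space.Closed where
  nonempty := let ⟨F, hF⟩ := X.space.fam_nonempty; ⟨X.space.upClosed ⟨F, hF⟩⟩
  isDcpo := CFSpace.isDcpo_closed
  isAlgebraic := CFSpace.isAlgebraic_closed X.R_refl
  exists_approximateIdentity := by
    obtain ⟨D, hn, hd, hid, hfin⟩ := X.isFS
    refine ⟨CFRel.toScottMap '' D, ⟨hn.image _, ?_, ?_, ?_⟩, ?_⟩
    · rintro _ ⟨Θ₁, h₁, rfl⟩ _ ⟨Θ₂, h₂, rfl⟩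
      obtain ⟨Θ, h, h₃, h₄⟩ := hd _ h₁ _ h₂
      have hle : ∀ {Υ : CFRel X.space X.space}, (∀ F G, Υ.rel F G → Θ.rel F G) →
          Υ.toScottMap ≤ Θ.toScottMap := fun hΥ E y hy => by
        obtain ⟨F, G, hF, hr, hy⟩ := CFRel.mem_toMap.1 hy
        exact CFRel.up_subset_toMap hF (hΥ _ _ hr) hy
      exact ⟨_, ⟨Θ, h, rfl⟩, hle h₃, hle h₄⟩
    · rintro _ ⟨Θ, h, rfl⟩ E y hy
      obtain ⟨F, G, hF, hr, hy⟩ := CFRel.mem_toMap.1 hy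
      exact CFSpace.up_subset_closed E hF
        (X.space.up_subset_up ((hid F G).1 ⟨Θ, h, hr⟩) hy)
    · intro g hg E x hx
      replace hx : x ∈ E.1 := hx
      obtain ⟨F, hF, h₁, -, h₂⟩ := E.2 {x} (by simpa using hx)
      obtain ⟨Θ, h, hr⟩ := (hid ⟨F, hF⟩ ⟨F, hF⟩).2 (CFSpace.subset_up X.R_refl _)
      exact hg ⟨Θ, h, rfl⟩ E (CFRel.up_subset_toMap h₂ hr (h₁ (by simp)))
    · rintro _ ⟨Θ, h, rfl⟩
      obtain ⟨ℳ, hℳ, hsep⟩ := hfin Θ h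
      exact CFRel.isFinitelySeparating_toScottMap hℳ hsep

/-! ### The space of compact elements of a BF-domain -/

section CompactSpace

variable {L : Type u} [PartialOrder L]

theorem IsBFDomain.exists_isCompactElement (hL : IsBFDomain L) : ∃ k : L, IsCompactElement k :=
  let ⟨x⟩ := hL.nonempty
  let ⟨k, hk⟩ := (hL.isAlgebraic x).1
  ⟨k, hk.2⟩

/-- The compact elements of a BF-domain with the induced order, the family consisting of the
singletons. -/
def compactSpace (hL : IsBFDomain L) : CFSpace.{u} where
  carrier := {k : L // IsCompactElement k}
  carrier_nonempty := let ⟨k, hk⟩ := hL.exists_isCompactElement; ⟨⟨k, hk⟩⟩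
  R k l := k ≤ l
  R_nonempty := let ⟨k, hk⟩ := hL.exists_isCompactElement; ⟨⟨k, hk⟩, ⟨k, hk⟩, le_rfl⟩
  R_trans _ _ _ := le_trans
  fam := Set.range singleton
  fam_nonempty := let ⟨k, hk⟩ := hL.exists_isCompactElement; ⟨_, ⟨k, hk⟩, rfl⟩
  consistent := by
    rintro _ ⟨k, rfl⟩ K hK
    refine ⟨_, ⟨k, rfl⟩, hK, ?_⟩
    intro x hx
    exact ⟨x, le_rfl, hx⟩

theorem compactSpace_refl (hL : IsBFDomain L) (k : (compactSpace hL).carrier) :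
    (compactSpace hL).R k k :=
  le_refl (α := {k : L // IsCompactElement k}) k

theorem mem_up_singleton (hL : IsBFDomain L) {k l : {k : L // IsCompactElement k}} :
    k ∈ (compactSpace hL).up ({l} : Finset {k : L // IsCompactElement k}) ↔ k.1 ≤ l.1 := by
  constructor
  · rintro ⟨y, h, hy⟩
    obtain rfl : y = l := Finset.mem_singleton.1 (Finset.mem_coe.1 hy)
    exact h
  · intro h
    exact ⟨l, h, Finset.mem_coe.2 (Finset.mem_singleton_self l)⟩

/-- The closed set of all compact elements below `x`. -/
def compactBelow (hL : IsBFDomain L) (x : L) : (compactSpace hL).Closed :=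
  ⟨{k : {k : L // IsCompactElement k} | k.1 ≤ x}, by
    intro K hK
    obtain ⟨hne, hdir, -⟩ := hL.isAlgebraic x
    obtain ⟨c, hc, hle⟩ := exists_mem_forall_le_of_finite hne hdir
      (K.finite_toSet.image Subtype.val)
      (by rintro _ ⟨k, hk, rfl⟩; exact ⟨hK hk, k.2⟩)
    refine ⟨_, ⟨⟨c, hc.2⟩, rfl⟩, ?_, ?_, ?_⟩
    · intro k hk
      exact (mem_up_singleton hL).2 (hle _ ⟨k, hk, rfl⟩)
    · intro k hk
      exact ((mem_up_singleton hL).1 hk).trans hc.1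
    · intro k hk
      obtain rfl := Finset.mem_singleton.1 (Finset.mem_coe.1 hk)
      exact hc.1⟩

theorem compactBelow_le_iff (hL : IsBFDomain L) {x y : L} :
    compactBelow hL x ≤ compactBelow hL y ↔ x ≤ y := by
  constructor
  · intro h
    refine (hL.isAlgebraic x).2.2.2 ?_
    rintro k ⟨hk, hc⟩
    exact h (show (⟨k, hc⟩ : {k : L // IsCompactElement k}) ∈ (compactBelow hL x).1 from hk)
  · intro h k hk
    exact le_trans (b := x) hk h

theorem compactBelow_surjective (hL : IsBFDomain L) : Function.Surjective (compactBelow hL) := by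
  intro E
  have hE : ∀ K : Finset {k : L // IsCompactElement k},
      (K : Set {k : L // IsCompactElement k}) ⊆ E.1 → ∃ c ∈ E.1, ∀ k ∈ K, k.1 ≤ c.1 := by
    intro K hK
    obtain ⟨_, ⟨c, rfl⟩, h₁, -, h₂⟩ := E.2 K hK
    exact ⟨c, h₂ (Finset.mem_coe.2 (Finset.mem_singleton_self c)), fun k hk =>
      (mem_up_singleton hL).1 (h₁ hk)⟩
  have hlow : ∀ k l : {k : L // IsCompactElement k}, k.1 ≤ l.1 → l ∈ E.1 → k ∈ E.1 := by
    intro k l hkl hl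
    refine CFSpace.up_subset_closed E (F := ({l} : Finset {k : L // IsCompactElement k})) ?_
      ((mem_up_singleton hL).2 hkl)
    intro x hx
    obtain rfl := Finset.mem_singleton.1 (Finset.mem_coe.1 hx)
    exact hl
  have hn : (Subtype.val '' (E.1 : Set {k : L // IsCompactElement k})).Nonempty := by
    obtain ⟨c, hc, -⟩ := hE ∅ fun x hx => absurd hx (Finset.notMem_empty x)
    exact ⟨_, c, hc, rfl⟩
  have hd : DirectedOn (· ≤ ·) (Subtype.val '' (E.1 : Set {k : L // IsCompactElement k})) := by
    classical
    rintro _ ⟨k, hk, rfl⟩ _ ⟨l, hl, rfl⟩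
    obtain ⟨c, hc, h⟩ := hE {k, l} (by
      intro x hx
      rcases Finset.mem_insert.1 (Finset.mem_coe.1 hx) with rfl | hx
      · exact hk
      · obtain rfl := Finset.mem_singleton.1 hx
        exact hl)
    exact ⟨_, ⟨c, hc, rfl⟩, h k (by simp), h l (by simp)⟩
  obtain ⟨s, hs⟩ := hL.isDcpo _ hn hd
  refine ⟨s, Subtype.ext (Set.Subset.antisymm ?_ ?_)⟩
  · intro k hk
    obtain ⟨_, ⟨l, hl, rfl⟩, hkl⟩ := k.2 _ s hn hd hs hk
    exact hlow k l hkl hl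
  · intro k hk
    exact hs.1 ⟨k, hk, rfl⟩

/-- A BF-domain is isomorphic to the poset of ideals of its compact elements. -/
noncomputable def closedCompactSpaceIso (hL : IsBFDomain L) : L ≃o (compactSpace hL).Closed :=
  RelIso.ofSurjective (OrderEmbedding.ofMapLEIff (compactBelow hL) fun _ _ =>
    compactBelow_le_iff hL) (compactBelow_surjective hL)

theorem mem_closedCompactSpaceIso (hL : IsBFDomain L) {x : L}
    {k : {k : L // IsCompactElement k}} : k ∈ (closedCompactSpaceIso hL x).1 ↔ k.1 ≤ x :=
  Iff.rfl

theorem closedCompactSpaceIso_symm_upClosed (hL : IsBFDomain L)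
    (k : {k : L // IsCompactElement k}) :
    (closedCompactSpaceIso hL).symm ((compactSpace hL).upClosed ⟨{k}, k, rfl⟩) = k.1 := by
  rw [OrderIso.symm_apply_eq]
  exact Subtype.ext (Set.ext fun _ => mem_up_singleton hL)

/-- The relation on the space of compact elements induced by a Scott continuous self-map of the
domain. -/
noncomputable def compactRel (hL : IsBFDomain L) (f : ScottMap L L) :
    CFRel (compactSpace hL) (compactSpace hL) :=
  CFRel.ofScottMap (compactSpace_refl hL) (compactSpace_refl hL)
    ((ScottMap.ofOrderIso (closedCompactSpaceIso hL)).comp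
      (f.comp (ScottMap.ofOrderIso (closedCompactSpaceIso hL).symm)))

theorem compactRel_singleton (hL : IsBFDomain L) (f : ScottMap L L)
    (k l : {k : L // IsCompactElement k}) :
    (compactRel hL f).rel ⟨{k}, k, rfl⟩ ⟨{l}, l, rfl⟩ ↔ l.1 ≤ f.toFun k.1 := by
  have h : ∀ S : Set {k : L // IsCompactElement k},
      ((({l} : Finset {k : L // IsCompactElement k}) : Set {k : L // IsCompactElement k}) ⊆ S ↔
        l ∈ S) := fun S => by simp
  refine (h _).trans ((mem_closedCompactSpaceIso hL).trans ?_)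
  change l.1 ≤ f.toFun ((closedCompactSpaceIso hL).symm _) ↔ _
  rw [closedCompactSpaceIso_symm_upClosed]

theorem singleton_subset_up_iff (hL : IsBFDomain L) {k l : {k : L // IsCompactElement k}} :
    ((({k} : Finset {k : L // IsCompactElement k}) : Set {k : L // IsCompactElement k}) ⊆
      (compactSpace hL).up ({l} : Finset {k : L // IsCompactElement k})) ↔ k.1 ≤ l.1 := by
  rw [Finset.coe_singleton]
  exact Set.singleton_subset_iff.trans (mem_up_singleton hL)

theorem isFS_compactSpace (hL : IsBFDomain L) : (compactSpace hL).IsFS := by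
  obtain ⟨D, hD, hsep⟩ := hL.exists_approximateIdentity
  have hle : ∀ δ ∈ D, ∀ x, δ.toFun x ≤ x := fun δ hδ => hD.2.2.1 hδ
  refine ⟨(fun δ => compactRel hL (δ.comp δ)) '' D, hD.1.image _, ?_, ?_, ?_⟩
  · rintro _ ⟨δ₁, h₁, rfl⟩ _ ⟨δ₂, h₂, rfl⟩
    obtain ⟨δ, h, h₃, h₄⟩ := hD.2.1 _ h₁ _ h₂
    have hmono : ∀ ε : ScottMap L L, ε ≤ δ → ∀ F G, (compactRel hL (ε.comp ε)).rel F G →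
        (compactRel hL (δ.comp δ)).rel F G := by
      rintro ε hε ⟨_, k, rfl⟩ ⟨_, l, rfl⟩ hr
      exact (compactRel_singleton hL _ k l).2 (((compactRel_singleton hL _ k l).1 hr).trans
        ((ε.scottContinuous.monotone (hε _)).trans (hε _)))
    exact ⟨_, ⟨δ, h, rfl⟩, hmono _ h₃, hmono _ h₄⟩
  · rintro ⟨_, k, rfl⟩ ⟨_, l, rfl⟩
    refine Iff.trans ?_ (singleton_subset_up_iff hL).symm
    constructor
    · rintro ⟨_, ⟨δ, hδ, rfl⟩, hr⟩
      exact ((compactRel_singleton hL _ k l).1 hr).trans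
        ((hle δ hδ _).trans (hle δ hδ _))
    · intro hlk
      -- Compactness of `l` is used twice: to reach `δ₁ k`, and to reach `δ₂ l`.
      have happ : ∀ x, l.1 ≤ x → ∃ δ ∈ D, l.1 ≤ δ.toFun x := by
        intro x hx
        obtain ⟨_, ⟨δ, hδ, rfl⟩, h⟩ := l.2 _ x (hD.1.image _) (by
          rintro _ ⟨δ₁, h₁, rfl⟩ _ ⟨δ₂, h₂, rfl⟩
          obtain ⟨δ, h, h₃, h₄⟩ := hD.2.1 _ h₁ _ h₂
          exact ⟨_, ⟨δ, h, rfl⟩, h₃ x, h₄ x⟩) (hD.isLUB_apply hL.isDcpo x) hx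
        exact ⟨δ, hδ, h⟩
      obtain ⟨δ₁, h₁, hk⟩ := happ k.1 hlk
      obtain ⟨δ₂, h₂, hl⟩ := happ l.1 le_rfl
      obtain ⟨δ, hδ, h₃, h₄⟩ := hD.2.1 _ h₁ _ h₂
      exact ⟨_, ⟨δ, hδ, rfl⟩, (compactRel_singleton hL _ k l).2 ((hl.trans (h₄ _)).trans
        (δ.scottContinuous.monotone (hk.trans (h₃ _))))⟩
  · rintro _ ⟨δ, hδ, rfl⟩
    obtain ⟨m, hm, hδm⟩ := hsep δ hδ
    choose c hc hδc hca using exists_compact_between hL.isAlgebraic (hsep δ hδ)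
    refine ⟨(fun a => ⟨{⟨c a, hc a⟩}, _, rfl⟩) '' m, hm.image _, ?_⟩
    rintro ⟨_, k, rfl⟩
    obtain ⟨a, ha, h₁, h₂⟩ := hδm k.1
    refine ⟨_, ⟨a, ha, rfl⟩, ?_⟩
    rintro ⟨_, l, rfl⟩ hr
    constructor
    · exact (singleton_subset_up_iff hL).2 (((compactRel_singleton hL _ k l).1 hr).trans
        ((δ.scottContinuous.monotone h₁).trans (hδc a)))
    · exact CFSpace.up_subset_up _ ((singleton_subset_up_iff hL).2 ((hca a).trans h₂))

end CompactSpace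

/-! ### The equivalence of categories -/

/-- The functor sending a space to its CF-closed sets and a relation `Θ` to `f_Θ`. -/
def closedFunctor : TopFSApps.{u} ⥤ BFDom.{u} where
  obj X := { carrier := X.space.Closed, isBFDomain := X.isBFDomain_closed }
  map Θ := { toFun := CFRel.toMap Θ, scottContinuous := CFRel.scottContinuous_toMap Θ }
  map_id X := ScottMap.ext (funext (CFRel.toMap_id X.space))
  map_comp Θ Υ := ScottMap.ext (funext (CFRel.toMap_comp Υ Θ))

instance : closedFunctor.{u}.Faithful where
  map_injective {X Y} _ _ h :=
    CFRel.toMap_injective X.R_refl Y.R_refl (congrArg ScottMap.toFun h)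

instance : closedFunctor.{u}.Full where
  map_surjective {X Y} f :=
    ⟨CFRel.ofScottMap X.R_refl Y.R_refl f, CFRel.toMap_ofScottMap X.R_refl Y.R_refl f⟩

instance : closedFunctor.{u}.EssSurj where
  mem_essImage L :=
    let e := closedCompactSpaceIso L.isBFDomain
    ⟨⟨compactSpace L.isBFDomain, compactSpace_refl _, isFS_compactSpace _⟩,
      ⟨{ hom := ScottMap.ofOrderIso e.symm
         inv := ScottMap.ofOrderIso e
         hom_inv_id := ScottMap.ext (funext e.apply_symm_apply)
         inv_hom_id := ScottMap.ext (funext e.symm_apply_apply) }⟩⟩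

end FSApprox

/-- The assignment `X ↦ (CF-closed sets of X, ⊆)`, `Θ ↦ f_Θ` is well defined as a map from
topological FS-approximation spaces to BF-domains, it is a functor, and this functor is an
equivalence of categories. -/
theorem mainTheorem11 :
    ∃ (hobj : ∀ X : FSApprox.TopFSApps.{u}, FSApprox.IsBFDomain X.space.Closed)
      (hmap : ∀ (X Y : FSApprox.TopFSApps.{u}) (Θ : FSApprox.CFRel X.space Y.space),
        ScottContinuous Θ.toMap)
      (Ψ : FSApprox.TopFSApps.{u} ⥤ FSApprox.BFDom.{u}),
      Ψ.toPrefunctor =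
        { obj := fun X => { carrier := X.space.Closed, isBFDomain := hobj X }
          map := fun {X Y} Θ => { toFun := FSApprox.CFRel.toMap Θ,
                                  scottContinuous := hmap X Y Θ } } ∧
      Ψ.IsEquivalence :=
  ⟨FSApprox.TopFSApps.isBFDomain_closed, fun _ _ => FSApprox.CFRel.scottContinuous_toMap,
    FSApprox.closedFunctor, rfl, { }⟩
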